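/- Let $\mathcal{O}$ be a complete discrete valuation ring with finite residue field and let $\Lambda=\mathcal{O}[[T]]$ be the ring of formal power series in one variable over $\mathcal{O}$. For a finitely generated $\Lambda$-module $M$ and an integer $i\ge 0$, the $i$-th Fitting ideal $\mathrm{Fitt}_i(M)$ is defined by choosing a presentation $\Lambda^k\xrightarrow{A}\Lambda^n\to M\to 0$ and letting $\mathrm{Fitt}_i(M)$ be the ideal generated by the minors of order $n-i$ of $A$ if $i\le n$, and $\mathrm{Fitt}_i(M)=\Lambda$ if $i>n$ (this does not depend on the presentation). A finitely generated $\Lambda$-module $P$ is pseudo-null if $P_{\mathfrak p}=0$ for every prime ideal $\mathfrak p$ of $\Lambda$ of height at most $1$; finitely generated $\Lambda$-modules $M$ and $N$ are pseudo-isomorphic if there is a $\Lambda$-linear map $f:M\to N$ such that $\ker(f)$ and $\mathrm{coker}(f)$ are pseudo-null. For ideals $I,J$ of $\Lambda$ write $I\sim J$ if there are ideals $\mathfrak a,\mathfrak b$ of $\Lambda$ of height $2$ such that $\mathfrak a I\subseteq J$ and $\mathfrak b J\subseteq I$. **Theorem.** Let $M$ be a non-trivial finitely generated torsion $\Lambda$-module.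 The pseudo-isomorphism class of $M$ is uniquely determined by the classes modulo $\sim$ of the ideals $\mathrm{Fitt}_i(M)$ for $i\ge 0$; that is, for every finitely generated torsion $\Lambda$-module $N$, the modules $M$ and $N$ are pseudo-isomorphic if and only if $\mathrm{Fitt}_i(M)\sim\mathrm{Fitt}_i(N)$ for all $i\ge 0$. -/

import Mathlib

open scoped PowerSeries

section FittingIdeals

variable {R : Type*} [CommRing R]

/-- The ideal `I_r(A)` generated by the minors of order `r` of the matrix `A`. Rows and columns are
selected by arbitrary functions: a repetition gives determinant `0`, and a permutation only changes
the sign. In particular `I_0(A) = R`, and `I_r(A) = 0` when `r` exceeds the number of rows or the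
number of columns. -/
def minorIdeal {m k : Type*} (A : Matrix m k R) (r : ℕ) : Ideal R :=
  Ideal.span {d | ∃ (f : Fin r → m) (g : Fin r → k), d = (A.submatrix f g).det}

/-- The matrix `A` and the map `π` form a presentation `R^k --A--> R^n --π--> M --> 0`. -/
structure IsMatrixPresentation {M : Type*} [AddCommGroup M] [Module R M] {n k : ℕ}
    (A : Matrix (Fin n) (Fin k) R) (π : (Fin n → R) →ₗ[R] M) : Prop where
  exact : LinearMap.range A.mulVecLin = LinearMap.ker π
  surjective : Function.Surjective π

/-- The `i`-th Fitting ideal read off a matrix with `n` rows: `I_{n-i}(A)` for `i ≤ n`, and the unit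
ideal for `i > n`. -/
def matrixFittingIdeal {n k : ℕ} (A : Matrix (Fin n) (Fin k) R) (i : ℕ) : Ideal R :=
  if i ≤ n then minorIdeal A (n - i) else ⊤

open Classical in
/-- The `i`-th Fitting ideal of a finitely presented module `M`: choose a finite presentation with
matrix `A` and take `I_{n-i}(A)`. It does not depend on the choice, see `fittingIdeal_eq` below.
(The value is `0` for modules without finite presentation.) -/
noncomputable def fittingIdeal (R : Type*) [CommRing R] (M : Type*) [AddCommGroup M] [Module R M]
    (i : ℕ) : Ideal R :=
  if h : ∃ (n k : ℕ) (A : Matrix (Fin n) (Fin k) R) (π : (Fin n → R) →ₗ[R] M),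
      IsMatrixPresentation A π
  then matrixFittingIdeal h.choose_spec.choose_spec.choose i
  else ⊥

/-! Independence of the presentation. -/

theorem det_submatrix_mem_minorIdeal {m k ι : Type*} [Fintype ι] [DecidableEq ι]
    (A : Matrix m k R) {r : ℕ} (h : Fintype.card ι = r) (f : ι → m) (g : ι → k) :
    (A.submatrix f g).det ∈ minorIdeal A r := by
  let e : Fin r ≃ ι := (Fintype.equivFinOfCardEq h).symm
  refine Ideal.subset_span ⟨f ∘ e, g ∘ e, ?_⟩
  rw [← Matrix.submatrix_submatrix, Matrix.det_submatrix_equiv_self]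

theorem minorIdeal_le {m k : Type*} {A : Matrix m k R} {r : ℕ} {I : Ideal R}
    (h : ∀ (f : Fin r → m) (g : Fin r → k), (A.submatrix f g).det ∈ I) : minorIdeal A r ≤ I := by
  refine Ideal.span_le.2 ?_
  rintro _ ⟨f, g, rfl⟩
  exact h f g

theorem minorIdeal_zero {m k : Type*} (A : Matrix m k R) : minorIdeal A 0 = ⊤ := by
  rw [Ideal.eq_top_iff_one]
  exact Ideal.subset_span ⟨Fin.elim0, Fin.elim0, by simp⟩

theorem matrixFittingIdeal_eq_minorIdeal {n k : ℕ} (A : Matrix (Fin n) (Fin k) R) (i : ℕ) :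
    matrixFittingIdeal A i = minorIdeal A (n - i) := by
  unfold matrixFittingIdeal
  split_ifs with h
  · rfl
  · rw [Nat.sub_eq_zero_of_le (by omega), minorIdeal_zero]

theorem minorIdeal_transpose_le {m k : Type*} (A : Matrix m k R) (r : ℕ) :
    minorIdeal A.transpose r ≤ minorIdeal A r := by
  refine minorIdeal_le fun f g => ?_
  rw [← Matrix.det_transpose]
  exact det_submatrix_mem_minorIdeal A (by simp) g f

theorem minorIdeal_mul_le_right {m l k : Type*} [Fintype l] (P : Matrix m l R) (A : Matrix l k R)
    (r : ℕ) : minorIdeal (P * A) r ≤ minorIdeal A r := by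
  classical
  refine minorIdeal_le fun f g => ?_
  have h1 : (P * A).submatrix f g = fun a => ∑ x, P (f a) x • (fun b => A x (g b)) := by
    ext a b
    simp [Matrix.mul_apply]
  have h2 : ((P * A).submatrix f g).det
      = ∑ c : Fin r → l, (∏ a, P (f a) (c a)) * (A.submatrix c g).det := by
    rw [h1]
    change (Matrix.detRowAlternating (R := R) (n := Fin r)).toMultilinearMap
      (fun a => ∑ x, P (f a) x • (fun b => A x (g b))) = _
    rw [MultilinearMap.map_sum]
    refine Finset.sum_congr rfl fun c _ => ?_
    rw [MultilinearMap.map_smul_univ]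
    rfl
  rw [h2]
  exact Ideal.sum_mem _ fun c _ =>
    Ideal.mul_mem_left _ _ (det_submatrix_mem_minorIdeal A (by simp) c g)

theorem minorIdeal_mul_le_left {m l k : Type*} [Fintype l] (A : Matrix m l R) (Q : Matrix l k R)
    (r : ℕ) : minorIdeal (A * Q) r ≤ minorIdeal A r := by
  have h := minorIdeal_transpose_le (A * Q).transpose r
  rw [Matrix.transpose_transpose, Matrix.transpose_mul] at h
  exact h.trans ((minorIdeal_mul_le_right _ _ r).trans (minorIdeal_transpose_le A r))

theorem minorIdeal_succ_le {m k : Type*} (A : Matrix m k R) (r : ℕ) :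
    minorIdeal A (r + 1) ≤ minorIdeal A r := by
  refine minorIdeal_le fun f g => ?_
  rw [Matrix.det_succ_row_zero]
  refine Ideal.sum_mem _ fun j _ => Ideal.mul_mem_left _ _ ?_
  rw [Matrix.submatrix_submatrix]
  exact det_submatrix_mem_minorIdeal A (by simp) _ _

theorem exists_map_castSucc {α : Type*} {t : ℕ} (x : α ⊕ Fin (t + 1))
    (hx : x ≠ Sum.inr (Fin.last t)) : ∃ y : α ⊕ Fin t, x = Sum.map id Fin.castSucc y := by
  rcases x with x | x
  · exact ⟨Sum.inl x, rfl⟩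
  · obtain ⟨y, hy⟩ := Fin.exists_castSucc_eq (i := x) |>.2 (fun h => hx (by rw [h]))
    exact ⟨Sum.inr y, by rw [← hy]; rfl⟩

theorem minorIdeal_fromBlocks_one_le {m k : Type*} (A : Matrix m k R) (t r : ℕ) :
    minorIdeal (Matrix.fromBlocks A 0 0 (1 : Matrix (Fin t) (Fin t) R)) (r + t)
      ≤ minorIdeal A r := by
  classical
  induction t generalizing r with
  | zero =>
    refine minorIdeal_le fun f g => ?_
    have hf : ∀ a, ∃ b, f a = Sum.inl b := fun a => by
      rcases f a with b | b
      · exact ⟨b, rfl⟩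
      · exact b.elim0
    have hg : ∀ a, ∃ b, g a = Sum.inl b := fun a => by
      rcases g a with b | b
      · exact ⟨b, rfl⟩
      · exact b.elim0
    choose f' hf' using hf
    choose g' hg' using hg
    have : (Matrix.fromBlocks A 0 0 (1 : Matrix (Fin 0) (Fin 0) R)).submatrix f g
        = A.submatrix f' g' := by
      ext a b
      simp [hf', hg']
    rw [this]
    exact det_submatrix_mem_minorIdeal A (by simp) _ _
  | succ t ih =>
    refine minorIdeal_le fun f g => ?_
    set B := Matrix.fromBlocks A 0 0 (1 : Matrix (Fin (t + 1)) (Fin (t + 1)) R) with hB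
    set C := Matrix.fromBlocks A 0 0 (1 : Matrix (Fin t) (Fin t) R) with hC
    -- the minors of `B` that avoid the last row
    have key : ∀ (s : ℕ) (f : Fin s → m ⊕ Fin (t + 1)) (g : Fin s → k ⊕ Fin (t + 1)),
        (∀ a, f a ≠ Sum.inr (Fin.last t)) → (B.submatrix f g).det ∈ minorIdeal C s := by
      intro s f g hf
      by_cases hg : ∃ b, g b = Sum.inr (Fin.last t)
      · obtain ⟨b, hb⟩ := hg
        rw [Matrix.det_eq_zero_of_column_eq_zero b]
        · exact Ideal.zero_mem _
        · intro a
          have := hf a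
          rw [Matrix.submatrix_apply, hb]
          rcases h : f a with x | x
          · simp [hB]
          · have hx : x ≠ Fin.last t := fun hx => this (by rw [h, hx])
            simp [hB, Matrix.one_apply_ne hx]
      · push Not at hg
        choose f' hf' using fun a => exists_map_castSucc (f a) (hf a)
        choose g' hg' using fun a => exists_map_castSucc (g a) (hg a)
        have : B.submatrix f g = C.submatrix f' g' := by
          ext a b
          rw [Matrix.submatrix_apply, Matrix.submatrix_apply, hf', hg']
          rcases f' a with x | x <;> rcases g' b with y | y <;>
            simp [hB, hC, Matrix.one_apply]
        rw [this]
        exact det_submatrix_mem_minorIdeal C (by simp) _ _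
    by_cases hf : ∃ a, f a = Sum.inr (Fin.last t)
    · obtain ⟨a, ha⟩ := hf
      by_cases hinj : Function.Injective f
      · rw [Matrix.det_succ_row _ a]
        refine Ideal.sum_mem _ fun j _ => Ideal.mul_mem_left _ _ ?_
        rw [Matrix.submatrix_submatrix]
        refine ih r (key _ _ _ fun b hb => ?_)
        exact Fin.succAbove_ne a b (hinj (hb.trans ha.symm))
      · rw [Function.Injective] at hinj
        push Not at hinj
        obtain ⟨x, y, hxy, hne⟩ := hinj
        rw [Matrix.det_zero_of_row_eq hne]
        · exact Ideal.zero_mem _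
        · funext j
          simp [hxy]
    · push Not at hf
      exact ih r (minorIdeal_succ_le C (r + t) (key _ f g hf))

theorem IsMatrixPresentation.fitting_le {M : Type*} [AddCommGroup M] [Module R M] {n k n' k' : ℕ}
    {A : Matrix (Fin n) (Fin k) R} {π : (Fin n → R) →ₗ[R] M}
    {A' : Matrix (Fin n') (Fin k') R} {π' : (Fin n' → R) →ₗ[R] M}
    (h : IsMatrixPresentation A π) (h' : IsMatrixPresentation A' π') (i : ℕ) :
    matrixFittingIdeal A' i ≤ matrixFittingIdeal A i := by
  classical
  rw [matrixFittingIdeal_eq_minorIdeal, matrixFittingIdeal_eq_minorIdeal]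
  by_cases hi : n < i
  · rw [Nat.sub_eq_zero_of_le hi.le, minorIdeal_zero]
    exact le_top
  -- each system of generators in terms of the other one
  choose b hb using fun j => h.surjective (π' (Pi.single j 1))
  choose c hc using fun j => h'.surjective (π (Pi.single j 1))
  let B : Matrix (Fin n) (Fin n') R := Matrix.of fun x y => b y x
  let C : Matrix (Fin n') (Fin n) R := Matrix.of fun x y => c y x
  have hB : ∀ v, π (B.mulVec v) = π' v := by
    intro v
    have : π ∘ₗ B.mulVecLin = π' := by
      refine LinearMap.pi_ext' fun j => LinearMap.ext_ring ?_
      simp only [LinearMap.comp_apply, Matrix.mulVecLin_apply, LinearMap.coe_single,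
        Matrix.mulVec_single_one]
      exact hb j
    exact LinearMap.congr_fun this v
  let D := Matrix.fromBlocks A B 0 (-1 : Matrix (Fin n') (Fin n') R)
  let D' := Matrix.fromBlocks (-1 : Matrix (Fin n) (Fin n) R) 0 C A'
  have hD : ∀ u v, π u + π' v = 0 → ∃ w, D.mulVec w = Sum.elim u v := by
    intro u v huv
    have : u + B.mulVec v ∈ LinearMap.ker π := by
      rw [LinearMap.mem_ker, map_add, hB, huv]
    rw [← h.exact] at this
    obtain ⟨w, hw⟩ := this
    refine ⟨Sum.elim w (-v), ?_⟩
    rw [Matrix.mulVecLin_apply] at hw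
    rw [Matrix.fromBlocks_mulVec]
    simp [hw, Matrix.mulVec_neg, Matrix.neg_mulVec]
  have hcol : ∀ y, ∃ w, D.mulVec w = fun x => D' x y := by
    rintro (y | y)
    · obtain ⟨w, hw⟩ := hD (-Pi.single y 1) (c y) (by rw [map_neg, hc]; simp)
      refine ⟨w, hw.trans ?_⟩
      funext x
      rcases x with x | x
      · simp [D', Matrix.one_apply, Pi.single_apply]
      · simp [D', C]
    · have hz : π' (A'.mulVec (Pi.single y 1)) = 0 := by
        rw [← LinearMap.mem_ker, ← h'.exact]
        exact ⟨_, rfl⟩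
      obtain ⟨w, hw⟩ := hD 0 (A'.mulVec (Pi.single y 1)) (by rw [map_zero, hz, add_zero])
      refine ⟨w, hw.trans ?_⟩
      funext x
      rcases x with x | x <;> simp [D']
  choose q hq using hcol
  have hDQ : D' = D * Matrix.of fun x y => q y x := by
    ext x y
    have := congrFun (hq y) x
    rw [← this]
    rfl
  have hDP : D = (Matrix.fromBlocks 1 B 0 (-1) : Matrix (Fin n ⊕ Fin n') (Fin n ⊕ Fin n') R) *
      (Matrix.fromBlocks A 0 0 1 : Matrix (Fin n ⊕ Fin n') (Fin k ⊕ Fin n') R) := by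
    rw [Matrix.fromBlocks_multiply]
    simp [D]
  have step : minorIdeal D' (n - i + n') ≤ minorIdeal A (n - i) := by
    refine le_trans ?_ (minorIdeal_fromBlocks_one_le A n' (n - i))
    refine le_trans ?_ (hDP ▸ minorIdeal_mul_le_right _ _ _)
    exact hDQ ▸ minorIdeal_mul_le_left _ _ _
  refine le_trans ?_ step
  by_cases hi' : i ≤ n'
  · refine minorIdeal_le fun f g => ?_
    have hdet := det_submatrix_mem_minorIdeal (ι := Fin n ⊕ Fin (n' - i)) (r := n - i + n') D'
      (by simp; omega) (Sum.map id f) (Sum.map id g)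
    have hsub : D'.submatrix (Sum.map id f) (Sum.map id g)
        = Matrix.fromBlocks (-1) 0 (C.submatrix f id) (A'.submatrix f g) := by
      ext x y
      rcases x with x | x <;> rcases y with y | y <;> simp [D']
    rw [hsub, Matrix.det_fromBlocks_zero₁₂, Matrix.det_neg, Matrix.det_one, mul_one] at hdet
    have := Ideal.mul_mem_left _ ((-1 : R) ^ Fintype.card (Fin n)) hdet
    rwa [← mul_assoc, ← mul_pow, neg_one_mul, neg_neg, one_pow, one_mul] at this
  · have hle : n - i + n' ≤ n := by omega
    have hdet := det_submatrix_mem_minorIdeal (r := n - i + n') D' (by simp)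
      (fun x : Fin (n - i + n') => Sum.inl (Fin.castLE hle x))
      (fun x : Fin (n - i + n') => Sum.inl (Fin.castLE hle x))
    have hsub : D'.submatrix (fun x : Fin (n - i + n') => Sum.inl (Fin.castLE hle x))
        (fun x : Fin (n - i + n') => Sum.inl (Fin.castLE hle x)) = -1 := by
      ext x y
      simp [D', Matrix.one_apply]
    rw [hsub, Matrix.det_neg, Matrix.det_one, mul_one] at hdet
    have := Ideal.mul_mem_left _ ((-1 : R) ^ Fintype.card (Fin (n - i + n'))) hdet
    rw [← mul_pow, neg_one_mul, neg_neg, one_pow] at this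
    rw [(Ideal.eq_top_iff_one _).2 this]
    exact le_top

/-- The Fitting ideals can be computed from any finite presentation. -/
theorem fittingIdeal_eq {M : Type*} [AddCommGroup M] [Module R M] {n k : ℕ}
    {A : Matrix (Fin n) (Fin k) R} {π : (Fin n → R) →ₗ[R] M} (h : IsMatrixPresentation A π)
    (i : ℕ) : fittingIdeal R M i = matrixFittingIdeal A i := by
  have hex : ∃ (n k : ℕ) (A : Matrix (Fin n) (Fin k) R) (π : (Fin n → R) →ₗ[R] M),
      IsMatrixPresentation A π := ⟨n, k, A, π, h⟩
  have hs := hex.choose_spec.choose_spec.choose_spec.choose_spec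
  rw [fittingIdeal, dif_pos hex]
  exact le_antisymm (h.fitting_le hs i) (hs.fitting_le h i)

end FittingIdeals

section PseudoIsomorphism

variable (R : Type*) [CommRing R]

/-- A (finitely generated) module `M` is pseudo-null if `M_𝔭 = 0` for all prime ideals `𝔭` of height
at most `1`. -/
def IsPseudoNull (M : Type*) [AddCommGroup M] [Module R M] : Prop :=
  ∀ (p : Ideal R) [p.IsPrime], p.height ≤ 1 → Subsingleton (LocalizedModule p.primeCompl M)

/-- There is a pseudo-isomorphism from `M` to `N`: a homomorphism whose kernel and cokernel are
pseudo-null. -/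
def IsPseudoIsomorphic (M N : Type*) [AddCommGroup M] [Module R M] [AddCommGroup N] [Module R N] :
    Prop :=
  ∃ f : M →ₗ[R] N, IsPseudoNull R (LinearMap.ker f) ∧ IsPseudoNull R (N ⧸ LinearMap.range f)

variable {R}

/-- `I ≺ J`: there is an ideal `𝔞` of height `2` with `𝔞 I ⊆ J`. -/
def IdealPrec (I J : Ideal R) : Prop :=
  ∃ a : Ideal R, a.height = 2 ∧ a * I ≤ J

/-- `I ∼ J`: both `I ≺ J` and `J ≺ I`. -/
def IdealSim (I J : Ideal R) : Prop :=
  IdealPrec I J ∧ IdealPrec J I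

end PseudoIsomorphism

/-!
Both sides of the equivalence can be tested at the primes of height at most one. For ideals,
`I ≺ J` means that the colon ideal `(J : I)` has height at least two, i.e. lies in no prime `p` of
height at most one, i.e. that `I_p ⊆ J_p` for all these `p`. A homomorphism is a
pseudo-isomorphism when its localizations at these primes are bijective.

Fitting ideals commute with localization. At a prime of height one the local ring is a discrete
valuation ring, over which a torsion module is a sum of quotients `D/(d_i)` with
`d_1 ∣ d_2 ∣ ⋯ ∣ d_n`; its Fitting ideals are generated by the products `d_1 ⋯ d_r`, so they
determine each `d_i` up to a unit. Equal Fitting ideals thus give an isomorphism `M_p ≃ N_p`, which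
up to a unit comes from a homomorphism `f_p : M → N`. Only finitely many primes `p` of height one
contain `Ann M ∩ Ann N`, and `f = ∑ b_p f_p` is a pseudo-isomorphism if `b_p ∉ p` kills the
localizations of `N` at the other ones.
-/

section BaseChange

variable {R M N : Type*} [CommRing R] [AddCommGroup M] [Module R M] [AddCommGroup N] [Module R N]

theorem exists_isMatrixPresentation (R M : Type*) [CommRing R] [AddCommGroup M] [Module R M]
    [Module.FinitePresentation R M] :
    ∃ (n k : ℕ) (A : Matrix (Fin n) (Fin k) R) (π : (Fin n → R) →ₗ[R] M),
      IsMatrixPresentation A π := by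
  obtain ⟨n, k, π, g, hπ, hg⟩ := Module.FinitePresentation.exists_fin' R M
  refine ⟨n, k, LinearMap.toMatrix' g, π, ?_, hπ⟩
  rw [← Matrix.toLin'_apply', Matrix.toLin'_toMatrix', ← LinearMap.exact_iff.1 hg]

theorem IsMatrixPresentation.comp_equiv {n k : ℕ} {A : Matrix (Fin n) (Fin k) R}
    {π : (Fin n → R) →ₗ[R] M} (h : IsMatrixPresentation A π) (e : M ≃ₗ[R] N) :
    IsMatrixPresentation A (e.toLinearMap ∘ₗ π) where
  exact := by rw [h.exact, LinearEquiv.ker_comp]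
  surjective := e.surjective.comp h.surjective

theorem fittingIdeal_congr [Module.FinitePresentation R M] (e : M ≃ₗ[R] N) (i : ℕ) :
    fittingIdeal R M i = fittingIdeal R N i := by
  obtain ⟨n, k, A, π, h⟩ := exists_isMatrixPresentation R M
  rw [fittingIdeal_eq h, fittingIdeal_eq (h.comp_equiv e)]

theorem minorIdeal_map {S m k : Type*} [CommRing S] (φ : R →+* S) (A : Matrix m k R) (r : ℕ) :
    minorIdeal (A.map φ) r = (minorIdeal A r).map φ := by
  rw [minorIdeal, minorIdeal, Ideal.map_span]
  congr 1
  ext d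
  constructor
  · rintro ⟨f, g, rfl⟩
    exact ⟨_, ⟨f, g, rfl⟩, φ.map_det _⟩
  · rintro ⟨_, ⟨f, g, rfl⟩, rfl⟩
    exact ⟨f, g, φ.map_det _⟩

theorem IsMatrixPresentation.baseChange (S : Type*) [CommRing S] [Algebra R S] {n k : ℕ}
    {A : Matrix (Fin n) (Fin k) R} {π : (Fin n → R) →ₗ[R] M} (h : IsMatrixPresentation A π) :
    IsMatrixPresentation (A.map (algebraMap R S))
      (π.baseChange S ∘ₗ (TensorProduct.piScalarRight R S S (Fin n)).symm.toLinearMap) where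
  exact := by
    have hexact : Function.Exact (A.mulVecLin.baseChange S) (π.baseChange S) :=
      lTensor_exact S (LinearMap.exact_iff.2 h.exact.symm) h.surjective
    have hA : (A.map (algebraMap R S)).mulVecLin ∘ₗ (TensorProduct.piScalarRight R S S (Fin k)) =
        (TensorProduct.piScalarRight R S S (Fin n)).toLinearMap ∘ₗ A.mulVecLin.baseChange S := by
      ext j i
      simp [Matrix.mulVec, dotProduct, Pi.single_apply, Algebra.algebraMap_eq_smul_one]
    exact (LinearMap.exact_iff.1 (Function.Exact.of_ladder_linearEquiv_of_exact
      (e₃ := LinearEquiv.refl S _) hA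
      (LinearMap.ext fun x => congrArg (π.baseChange S) (LinearEquiv.symm_apply_apply _ x))
      hexact)).symm
  surjective :=
    (LinearMap.lTensor_surjective S h.surjective).comp (LinearEquiv.surjective _)

theorem fittingIdeal_eq_map_of_isBaseChange {S P : Type*} [CommRing S] [Algebra R S]
    [AddCommGroup P] [Module R P] [Module S P] [IsScalarTower R S P]
    [Module.FinitePresentation R M] {f : M →ₗ[R] P} (hf : IsBaseChange S f) (i : ℕ) :
    fittingIdeal S P i = (fittingIdeal R M i).map (algebraMap R S) := by
  obtain ⟨n, k, A, π, h⟩ := exists_isMatrixPresentation R M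
  rw [fittingIdeal_eq h, fittingIdeal_eq ((h.baseChange S).comp_equiv hf.equiv),
    matrixFittingIdeal_eq_minorIdeal, matrixFittingIdeal_eq_minorIdeal, minorIdeal_map]

end BaseChange

section DiagonalPresentation

variable {R : Type*} [CommRing R] {n : ℕ}

theorem prod_castLE_dvd_prod_of_injective {r : ℕ} (hr : r ≤ n) {d : Fin n → R}
    (hd : ∀ i j, i ≤ j → d i ∣ d j) {g : Fin r → Fin n} (hg : Function.Injective g) :
    ∏ i, d (Fin.castLE hr i) ∣ ∏ i, d (g i) := by
  have hmono : StrictMono (g ∘ Tuple.sort g) :=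
    (Tuple.monotone_sort g).strictMono_of_injective (hg.comp (Tuple.sort g).injective)
  have hle : ∀ i, Fin.castLE hr i ≤ (g ∘ Tuple.sort g) i := by
    intro i
    have hcard := Finset.card_le_card_of_injOn (g ∘ Tuple.sort g) (s := Finset.Iio i)
      (fun j hj => Finset.mem_Iio.2 (hmono (Finset.mem_Iio.1 hj))) hmono.injective.injOn
    rwa [Fin.card_Iio, Fin.card_Iio] at hcard
  rw [← Equiv.prod_comp (Tuple.sort g) fun i => d (g i)]
  exact Finset.prod_dvd_prod_of_dvd _ _ fun i _ => hd _ _ (hle i)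

theorem prod_dvd_det_submatrix_diagonal {r : ℕ} (d : Fin n → R) (f g : Fin r → Fin n) :
    ∏ i, d (g i) ∣ ((Matrix.diagonal d).submatrix f g).det := by
  have hfactor : (Matrix.diagonal d).submatrix f g =
      (1 : Matrix (Fin n) (Fin n) R).submatrix f g * Matrix.diagonal (d ∘ g) := by
    ext i j
    rw [Matrix.mul_diagonal]
    simp only [Matrix.submatrix_apply, Matrix.diagonal_apply, Matrix.one_apply]
    split_ifs with h <;> simp [h]
  rw [hfactor, Matrix.det_mul, Matrix.det_diagonal]
  exact dvd_mul_left _ _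

theorem minorIdeal_diagonal {r : ℕ} (hr : r ≤ n) {d : Fin n → R}
    (hd : ∀ i j, i ≤ j → d i ∣ d j) :
    minorIdeal (Matrix.diagonal d) r = Ideal.span {∏ i : Fin r, d (Fin.castLE hr i)} := by
  refine le_antisymm (minorIdeal_le fun f g => Ideal.mem_span_singleton.2 ?_) ?_
  · by_cases hg : Function.Injective g
    · exact (prod_castLE_dvd_prod_of_injective hr hd hg).trans
        (prod_dvd_det_submatrix_diagonal d f g)
    · obtain ⟨i, j, hij, hne⟩ := Function.not_injective_iff.1 hg
      rw [Matrix.det_zero_of_column_eq hne fun k => by simp only [Matrix.submatrix_apply, hij]]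
      exact dvd_zero _
  · refine (Ideal.span_singleton_le_iff_mem _).2 (Ideal.subset_span
      ⟨Fin.castLE hr, Fin.castLE hr, ?_⟩)
    rw [Matrix.submatrix_diagonal _ _ (Fin.castLE_injective hr), Matrix.det_diagonal]
    rfl

theorem isMatrixPresentation_diagonal (d : Fin n → R) :
    IsMatrixPresentation (Matrix.diagonal d)
      (LinearMap.pi fun i => (Ideal.span {d i}).mkQ ∘ₗ LinearMap.proj i) where
  exact := by
    ext v
    have hker : v ∈ LinearMap.ker (LinearMap.pi fun i =>
        (Ideal.span {d i}).mkQ ∘ₗ LinearMap.proj i) ↔ ∀ i, d i ∣ v i := by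
      simp [funext_iff, Ideal.Quotient.eq_zero_iff_dvd]
    rw [hker]
    constructor
    · rintro ⟨w, rfl⟩ i
      rw [Matrix.mulVecLin_apply, Matrix.mulVec_diagonal]
      exact dvd_mul_right _ _
    · intro h
      choose w hw using h
      exact ⟨w, funext fun i => by rw [Matrix.mulVecLin_apply, Matrix.mulVec_diagonal, hw]⟩
  surjective := by
    intro y
    choose v hv using fun i => (Ideal.span {d i}).mkQ_surjective (y i)
    exact ⟨v, funext hv⟩

theorem fittingIdeal_pi_quotient_span_singleton {r : ℕ} (hr : r ≤ n) {d : Fin n → R}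
    (hd : ∀ i j, i ≤ j → d i ∣ d j) :
    fittingIdeal R (∀ i, R ⧸ Ideal.span {d i}) (n - r) =
      Ideal.span {∏ i : Fin r, d (Fin.castLE hr i)} := by
  rw [fittingIdeal_eq (isMatrixPresentation_diagonal d), matrixFittingIdeal_eq_minorIdeal,
    Nat.sub_sub_self hr, minorIdeal_diagonal hr hd]

theorem associated_of_fittingIdeal_pi_quotient_eq [IsDomain R] {d d' : Fin n → R}
    (hd₀ : ∀ i, d i ≠ 0) (hd : ∀ i j, i ≤ j → d i ∣ d j) (hd' : ∀ i j, i ≤ j → d' i ∣ d' j)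
    (h : ∀ i, fittingIdeal R (∀ i, R ⧸ Ideal.span {d i}) i =
      fittingIdeal R (∀ i, R ⧸ Ideal.span {d' i}) i) (i : Fin n) :
    Associated (d i) (d' i) := by
  have hprod : ∀ r (hr : r ≤ n),
      Associated (∏ j : Fin r, d (Fin.castLE hr j)) (∏ j : Fin r, d' (Fin.castLE hr j)) := by
    intro r hr
    rw [← Ideal.span_singleton_eq_span_singleton, ← fittingIdeal_pi_quotient_span_singleton hr hd,
      h, fittingIdeal_pi_quotient_span_singleton hr hd']
  have hsucc := hprod (i + 1) i.2
  rw [Fin.prod_univ_castSucc, Fin.prod_univ_castSucc] at hsucc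
  exact hsucc.of_mul_left (hprod i i.2.le) (Finset.prod_ne_zero_iff.2 fun j _ => hd₀ _)

end DiagonalPresentation

section TorsionOverDiscreteValuationRing

theorem nonempty_linearEquiv_pi_comp_of_injective {R ι κ : Type*} [Semiring R] {φ : κ → Type*}
    [∀ k, AddCommMonoid (φ k)] [∀ k, Module R (φ k)] {σ : ι → κ} (hσ : Function.Injective σ)
    (hφ : ∀ k ∉ Set.range σ, Subsingleton (φ k)) :
    Nonempty ((∀ k, φ k) ≃ₗ[R] ∀ i, φ (σ i)) := by
  refine ⟨LinearEquiv.ofBijective (LinearMap.pi fun i => LinearMap.proj (σ i))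
    ⟨fun x y hxy => funext fun k => ?_, fun y => ?_⟩⟩
  · by_cases hk : k ∈ Set.range σ
    · obtain ⟨i, rfl⟩ := hk
      exact congrFun hxy i
    · exact (hφ k hk).elim _ _
  · have hy : ∀ k, ∃ x : φ k, ∀ i (h : σ i = k), h ▸ y i = x := by
      intro k
      by_cases hk : k ∈ Set.range σ
      · obtain ⟨i, rfl⟩ := hk
        exact ⟨y i, fun j hj => by obtain rfl := hσ hj; rfl⟩
      · exact ⟨0, fun i hi => absurd ⟨i, hi⟩ hk⟩
    choose x hx using hy
    exact ⟨x, funext fun i => (hx _ i rfl).symm⟩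

variable {D M N : Type*} [CommRing D] [IsDomain D] [IsDiscreteValuationRing D]
  [AddCommGroup M] [Module D M] [Module.Finite D M]
  [AddCommGroup N] [Module D N] [Module.Finite D N]

theorem exists_perm_forall_le_dvd {n : ℕ} (c : Fin n → D) :
    ∃ τ : Equiv.Perm (Fin n), ∀ i j, i ≤ j → c (τ i) ∣ c (τ j) :=
  ⟨_, fun _ _ hij => IsDiscreteValuationRing.addVal_le_iff_dvd.1
    (Tuple.monotone_sort (IsDiscreteValuationRing.addVal D ∘ c) hij)⟩

theorem exists_linearEquiv_pi_quotient_span (hM : Module.IsTorsion D M) :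
    ∃ n₀ : ℕ, ∀ n ≥ n₀, ∃ d : Fin n → D, (∀ i, d i ≠ 0) ∧ (∀ i j, i ≤ j → d i ∣ d j) ∧
      Nonempty (M ≃ₗ[D] ∀ i, D ⧸ Ideal.span {d i}) := by
  classical
  obtain ⟨ι, _, p, hp, e, ⟨φ⟩⟩ := Module.equiv_directSum_of_isTorsion hM
  refine ⟨Fintype.card ι, fun n hn => ?_⟩
  obtain ⟨σ, hσ⟩ := Function.Embedding.nonempty_of_card_le (β := Fin n) (by simpa using hn)
  -- Padding with ones makes the number of factors arbitrary, so that two modules can share it.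
  let c : Fin n → D := Function.extend σ (fun i => p i ^ e i) 1
  have hcσ : ∀ i, c (σ i) = p i ^ e i := hσ.extend_apply _ _
  have hc_one : ∀ k ∉ Set.range σ, c k = 1 := Function.extend_apply' _ _
  have hc_ne : ∀ k, c k ≠ 0 := by
    intro k
    by_cases hk : k ∈ Set.range σ
    · obtain ⟨i, rfl⟩ := hk
      exact hcσ i ▸ pow_ne_zero _ (hp i).ne_zero
    · exact hc_one k hk ▸ one_ne_zero
  obtain ⟨τ, hτ⟩ := exists_perm_forall_le_dvd c
  let φ₁ : (∀ i, D ⧸ Ideal.span {p i ^ e i}) ≃ₗ[D] ∀ i, D ⧸ Ideal.span {c (σ i)} :=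
    LinearEquiv.piCongrRight fun i => Submodule.quotEquivOfEq _ _ (by rw [hcσ])
  obtain ⟨φ₂⟩ := nonempty_linearEquiv_pi_comp_of_injective (R := D)
    (φ := fun k => D ⧸ Ideal.span {c k}) hσ fun k hk => by
      rw [hc_one k hk, Ideal.span_singleton_one]; infer_instance
  obtain ⟨φ₃⟩ := nonempty_linearEquiv_pi_comp_of_injective (R := D)
    (φ := fun k => D ⧸ Ideal.span {c k}) τ.injective fun k hk => absurd (τ.surjective k) hk
  exact ⟨c ∘ τ, fun i => hc_ne _, hτ,
    ⟨φ ≪≫ₗ DirectSum.linearEquivFunOnFintype D ι _ ≪≫ₗ φ₁ ≪≫ₗ φ₂.symm ≪≫ₗ φ₃⟩⟩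

theorem nonempty_linearEquiv_of_fittingIdeal_eq (hM : Module.IsTorsion D M)
    (hN : Module.IsTorsion D N) (h : ∀ i, fittingIdeal D M i = fittingIdeal D N i) :
    Nonempty (M ≃ₗ[D] N) := by
  have : Module.FinitePresentation D M := Module.finitePresentation_of_finite D M
  have : Module.FinitePresentation D N := Module.finitePresentation_of_finite D N
  obtain ⟨m, hm⟩ := exists_linearEquiv_pi_quotient_span hM
  obtain ⟨n, hn⟩ := exists_linearEquiv_pi_quotient_span hN
  obtain ⟨d, hd₀, hd, ⟨φ⟩⟩ := hm (max m n) (le_max_left _ _)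
  obtain ⟨d', -, hd', ⟨φ'⟩⟩ := hn (max m n) (le_max_right _ _)
  have hdd' := associated_of_fittingIdeal_pi_quotient_eq hd₀ hd hd' fun i => by
    rw [← fittingIdeal_congr φ, h, fittingIdeal_congr φ']
  let ψ : (∀ i, D ⧸ Ideal.span {d i}) ≃ₗ[D] ∀ i, D ⧸ Ideal.span {d' i} :=
    LinearEquiv.piCongrRight fun i =>
      Submodule.quotEquivOfEq _ _ (Ideal.span_singleton_eq_span_singleton.2 (hdd' i))
  exact ⟨φ ≪≫ₗ ψ ≪≫ₗ φ'.symm⟩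

end TorsionOverDiscreteValuationRing

section LocalizedMap

variable {R M N : Type*} [CommRing R] [AddCommGroup M] [Module R M] [AddCommGroup N] [Module R N]
  {S : Submonoid R}

theorem injective_localizedModule_map_iff (f : M →ₗ[R] N) :
    Function.Injective (LocalizedModule.map S f) ↔
      Subsingleton (LocalizedModule S (LinearMap.ker f)) := by
  let ιM := LocalizedModule.mkLinearMap S M
  let ιN := LocalizedModule.mkLinearMap S N
  have := LinearMap.toKerLocalized_isLocalizedModule (Localization S) S ιM ιN f
  rw [(IsLocalizedModule.iso S (LinearMap.toKerIsLocalized S ιM ιN f)).toEquiv.subsingleton_congr,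
    Submodule.subsingleton_iff_eq_bot, LinearMap.ker_eq_bot]
  rfl

theorem bijective_localizedModule_map_iff (f : M →ₗ[R] N) :
    Function.Bijective (LocalizedModule.map S f) ↔
      Subsingleton (LocalizedModule S (LinearMap.ker f)) ∧
        Subsingleton (LocalizedModule S (N ⧸ LinearMap.range f)) :=
  and_congr (injective_localizedModule_map_iff f)
    (LinearMap.localizedMap_surjective_iff_subsingleton_localized_coker S f)

theorem bijective_smul_localizedModule (s : S) :
    Function.Bijective fun z : LocalizedModule S M => s • z :=
  (Module.End.isUnit_iff _).1 (IsLocalizedModule.map_units (LocalizedModule.mkLinearMap S M) s)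

theorem exists_bijective_localizedModule_map [Module.FinitePresentation R M]
    (e : LocalizedModule S M ≃ₗ[Localization S] LocalizedModule S N) :
    ∃ f : M →ₗ[R] N, Function.Bijective (LocalizedModule.map S f) := by
  obtain ⟨f, s, hf⟩ := Module.FinitePresentation.exists_lift_of_isLocalizedModule S
    (LocalizedModule.mkLinearMap S N)
    ((e.restrictScalars R).toLinearMap ∘ₗ LocalizedModule.mkLinearMap S M)
  have hmap : (LocalizedModule.map S f).restrictScalars R =
      s • (e.restrictScalars R).toLinearMap := by
    refine IsLocalizedModule.linearMap_ext S (LocalizedModule.mkLinearMap S M)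
      (LocalizedModule.mkLinearMap S N) ?_
    rw [LinearMap.smul_comp, ← hf]
    ext x
    simp
  have : ⇑(LocalizedModule.map S f) = (fun z => s • z) ∘ e := congrArg DFunLike.coe hmap
  exact ⟨f, this ▸ (bijective_smul_localizedModule s).comp e.bijective⟩

theorem subsingleton_localizedModule_of_not_annihilator_le {p : Ideal R} [p.IsPrime]
    (hp : ¬ Module.annihilator R M ≤ p) : Subsingleton (LocalizedModule p.primeCompl M) := by
  obtain ⟨a, ha, hap⟩ := SetLike.not_le_iff_exists.1 hp
  exact LocalizedModule.subsingleton_iff.2 fun x => ⟨a, hap, Module.mem_annihilator.1 ha x⟩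

end LocalizedMap

section Gluing

variable {R : Type*} [CommRing R] {I : Ideal R}

theorem exists_notMem_mul_pow_mem_of_mem_minimalPrimes {q : Ideal R} (hq : q ∈ I.minimalPrimes)
    {x : R} (hx : x ∈ q) : ∃ t ∉ q, ∃ k : ℕ, t * x ^ k ∈ I := by
  have := hq.1.1
  have hrad := IsLocalization.AtPrime.radical_map_of_mem_minimalPrimes
    (Localization.AtPrime q) q I hq
  have hmem := hrad.ge (Ideal.mem_map_of_mem (algebraMap R (Localization.AtPrime q)) hx)
  obtain ⟨k, hk⟩ := hmem
  rw [← map_pow, IsLocalization.algebraMap_mem_map_algebraMap_iff q.primeCompl] at hk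
  obtain ⟨t, ht, htx⟩ := hk
  exact ⟨t, ht, k, htx⟩

variable {P : Set (Ideal R)}

theorem exists_notMem_forall_mem_mul_mem (hP : P.Finite) (hPI : P ⊆ I.minimalPrimes)
    {p : Ideal R} (hp : p ∈ P) : ∃ b ∉ p, ∀ q ∈ P, q ≠ p → ∃ t ∉ q, t * b ∈ I := by
  have := (hPI hp).1.1
  have hsep : ∀ q ∈ P, q ≠ p → ∃ b ∉ p, ∃ t ∉ q, t * b ∈ I := by
    intro q hq hqp
    have hle : ¬ q ≤ p := fun h => hqp (h.antisymm ((hPI hp).2 (hPI hq).1 h))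
    obtain ⟨x, hxq, hxp⟩ := SetLike.not_le_iff_exists.1 hle
    obtain ⟨t, ht, k, htx⟩ := exists_notMem_mul_pow_mem_of_mem_minimalPrimes (hPI hq) hxq
    exact ⟨x ^ k, fun h => hxp (Ideal.IsPrime.mem_of_pow_mem ‹_› k h), t, ht, htx⟩
  choose! b hbp t htq htb using hsep
  classical
  refine ⟨∏ q ∈ hP.toFinset.erase p, b q, ?_, fun q hq hqp => ⟨t q, htq q hq hqp, ?_⟩⟩
  · refine prod_mem (S := p.primeCompl) fun q hq => ?_
    exact hbp q (hP.mem_toFinset.1 (Finset.mem_of_mem_erase hq)) (Finset.ne_of_mem_erase hq)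
  · have hqmem := Finset.mem_erase.2 ⟨hqp, hP.mem_toFinset.2 hq⟩
    exact I.mem_of_dvd (mul_dvd_mul_left _ (Finset.dvd_prod_of_mem b hqmem)) (htb q hq hqp)

theorem exists_forall_mem_bijective_localizedModule_map {M N : Type*} [AddCommGroup M] [Module R M]
    [AddCommGroup N] [Module R N] (hP : P.Finite) (hPI : P ⊆ I.minimalPrimes)
    (hIN : I ≤ Module.annihilator R N)
    (h : ∀ p ∈ P, ∀ [p.IsPrime],
      ∃ f : M →ₗ[R] N, Function.Bijective (LocalizedModule.map p.primeCompl f)) :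
    ∃ f : M →ₗ[R] N, ∀ p ∈ P, ∀ [p.IsPrime],
      Function.Bijective (LocalizedModule.map p.primeCompl f) := by
  choose! b hbp t htq htb using
    fun p (hp : p ∈ P) => exists_notMem_forall_mem_mul_mem hP hPI hp
  choose! f hf using h
  refine ⟨∑ p ∈ hP.toFinset, b p • f p, fun q hq _ => ?_⟩
  have hvanish : ∀ p ∈ hP.toFinset, p ≠ q →
      LocalizedModule.map q.primeCompl (b p • f p) = 0 := by
    intro p hp hpq
    have hp := hP.mem_toFinset.1 hp
    have hzero : (t p q * b p) • f p = 0 := LinearMap.ext fun x =>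
      Module.mem_annihilator.1 (hIN (htb p hp q hq hpq.symm)) (f p x)
    refine LinearMap.ext fun z =>
      (bijective_smul_localizedModule (⟨t p q, htq p hp q hq hpq.symm⟩ : q.primeCompl)).injective ?_
    change (t p q • LocalizedModule.map q.primeCompl (b p • f p)) z = t p q • 0
    rw [← map_smul, smul_smul, hzero, map_zero, LinearMap.zero_apply, smul_zero]
  rw [map_sum, Finset.sum_eq_single q hvanish fun h => absurd (hP.mem_toFinset.2 hq) h, map_smul]
  exact (bijective_smul_localizedModule ⟨b q, hbp q hq⟩).comp (hf q hq)

end Gluing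

section IdealRelation

variable {R : Type*} [CommRing R] {I J : Ideal R}

theorem two_le_height_iff :
    2 ≤ I.height ↔ ∀ (p : Ideal R) [p.IsPrime], p.height ≤ 1 → ¬ I ≤ p := by
  refine ⟨fun hI p _ hp hIp => ?_, fun h => ?_⟩
  · exact absurd ((hI.trans (Ideal.height_mono hIp)).trans hp) (by norm_num)
  · rw [Ideal.height_eq_inf_minimalPrimes]
    refine le_iInf₂ fun p hp => ?_
    have := hp.1.1
    rw [← one_add_one_eq_two]
    exact Order.add_one_le_of_lt (not_le.1 fun hp1 => h p hp1 hp.1.2)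

theorem map_localization_le_map_iff_not_colon_le (hI : I.FG) {p : Ideal R} [p.IsPrime] :
    I.map (algebraMap R (Localization p.primeCompl)) ≤
        J.map (algebraMap R (Localization p.primeCompl)) ↔
      ¬ J.colon I ≤ p := by
  obtain ⟨s, rfl⟩ := hI
  have hmem : ∀ x, algebraMap R (Localization p.primeCompl) x ∈
      J.map (algebraMap R (Localization p.primeCompl)) ↔ ¬ J.colon {x} ≤ p := by
    intro x
    rw [IsLocalization.algebraMap_mem_map_algebraMap_iff p.primeCompl, SetLike.not_le_iff_exists]
    refine exists_congr fun t => ?_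
    rw [and_comm, Submodule.mem_colon_singleton]
    rfl
  have hcolon : J.colon (Ideal.span (s : Set R) : Set R) = s.inf fun x => J.colon {x} := by
    ext r
    rw [Submodule.colon_span]
    simp [Submodule.mem_colon]
  rw [Ideal.map_span, Ideal.span_le, Set.image_subset_iff, hcolon, Ideal.IsPrime.inf_le' ‹_›]
  simp [Set.subset_def, hmem]

theorem exists_isPrime_height_eq [IsNoetherianRing R] {n : ℕ} (hn : n ≤ ringKrullDim R) :
    ∃ p : Ideal R, p.IsPrime ∧ p.height = n := by
  obtain ⟨l, rfl⟩ := Order.le_krullDim_iff.1 hn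
  suffices ∃ p : PrimeSpectrum R, Order.height p = l.length by
    obtain ⟨p, hp⟩ := this
    exact ⟨p.asIdeal, p.isPrime, p.height_eq_orderHeight.trans hp⟩
  rcases (Order.length_le_height_last (p := l)).eq_or_lt with heq | hlt
  · exact ⟨_, heq.symm⟩
  · have hfin : Order.height l.last < ⊤ :=
      l.last.height_eq_orderHeight ▸ Ideal.height_lt_top_of_isPrime
    obtain ⟨p, -, hp⟩ := (Order.coe_lt_height_iff hfin).1 hlt
    exact ⟨p, hp⟩

theorem idealPrec_iff_two_le_height_colon [IsNoetherianRing R] (hR : 2 ≤ ringKrullDim R) :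
    IdealPrec I J ↔ 2 ≤ (J.colon I).height := by
  constructor
  · rintro ⟨a, ha, haI⟩
    exact ha.ge.trans (Ideal.height_mono fun r hr => Submodule.mem_colon.2 fun x hx =>
      haI (Ideal.mul_mem_mul hr hx))
  · intro h
    obtain ⟨m, -, hm : m.height = 2⟩ := exists_isPrime_height_eq (n := 2) hR
    -- The colon ideal can have height above two, but `≺` asks for height exactly two.
    refine ⟨J.colon I ⊓ m, ((Ideal.height_mono inf_le_right).trans hm.le).antisymm ?_,
      Ideal.mul_le.2 fun r hr x hx => Submodule.mem_colon.1 hr.1 x hx⟩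
    rw [two_le_height_iff] at h ⊢
    intro p hpp hp hle
    exact (hpp.inf_le.1 hle).elim (h p hp) (two_le_height_iff.1 hm.ge p hp)

theorem idealPrec_iff_forall_map_le [IsNoetherianRing R] (hR : 2 ≤ ringKrullDim R) :
    IdealPrec I J ↔ ∀ (p : Ideal R) [p.IsPrime], p.height ≤ 1 →
      I.map (algebraMap R (Localization p.primeCompl)) ≤
        J.map (algebraMap R (Localization p.primeCompl)) := by
  simp only [idealPrec_iff_two_le_height_colon hR, two_le_height_iff,
    map_localization_le_map_iff_not_colon_le (IsNoetherian.noetherian I)]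

theorem idealSim_iff_forall_map_eq [IsNoetherianRing R] (hR : 2 ≤ ringKrullDim R) :
    IdealSim I J ↔ ∀ (p : Ideal R) [p.IsPrime], p.height ≤ 1 →
      I.map (algebraMap R (Localization p.primeCompl)) =
        J.map (algebraMap R (Localization p.primeCompl)) := by
  simp only [IdealSim, idealPrec_iff_forall_map_le hR, ← forall_and, ← le_antisymm_iff]

end IdealRelation

section HeightOne

variable {R : Type*} [CommRing R]

theorem isDiscreteValuationRing_localization [IsDomain R] [IsNoetherianRing R]
    [IsIntegrallyClosed R] {p : Ideal R} [p.IsPrime] (hp : p.height = 1) :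
    IsDiscreteValuationRing (Localization p.primeCompl) := by
  have hS := p.primeCompl_le_nonZeroDivisors
  have hfield := IsLocalization.AtPrime.not_isField R (Ideal.ne_bot_of_height_eq_one hp)
    (Localization p.primeCompl)
  have : IsNoetherianRing (Localization p.primeCompl) :=
    IsLocalization.isNoetherianRing p.primeCompl _ ‹_›
  have : IsLocalRing (Localization p.primeCompl) :=
    IsLocalization.AtPrime.isLocalRing (Localization p.primeCompl) p
  have : IsIntegrallyClosed (Localization p.primeCompl) :=
    isIntegrallyClosed_of_isLocalization _ p.primeCompl hS
  have : Ring.KrullDimLE 1 (Localization p.primeCompl) := by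
    rw [Ring.krullDimLE_iff, IsLocalization.AtPrime.ringKrullDim_eq_height p, hp]
    rfl
  have : IsDomain (Localization p.primeCompl) := IsLocalization.isDomain_localization hS
  refine ((IsDiscreteValuationRing.TFAE (Localization p.primeCompl) hfield).out 0 2).2 ?_
  exact { maximalOfPrime := fun hq hq' => hq'.isMaximal_of_ne_bot hq }

theorem isTorsion_localizedModule {M : Type*} [AddCommGroup M] [Module R M]
    (hM : Module.IsTorsion R M) (S : Submonoid R) :
    Module.IsTorsion (Localization S) (LocalizedModule S M) := by
  intro z
  induction z with | _ x t
  obtain ⟨a, ha⟩ := @hM x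
  refine ⟨⟨algebraMap R (Localization S) a, IsLocalization.map_nonZeroDivisors_le S _
    (Submonoid.mem_map_of_mem _ a.2)⟩, ?_⟩
  change algebraMap R (Localization S) a • LocalizedModule.mk x t = 0
  rw [algebraMap_smul, LocalizedModule.smul'_mk]
  exact (congrArg (LocalizedModule.mk · t) ha).trans (LocalizedModule.zero_mk t)

theorem annihilator_ne_bot_of_isTorsion [Nontrivial R] {M : Type*} [AddCommGroup M] [Module R M]
    [Module.Finite R M] (hM : Module.IsTorsion R M) : Module.annihilator R M ≠ ⊥ := by
  obtain ⟨a, ha, ha₀⟩ := Submodule.annihilator_top_inter_nonZeroDivisors hM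
  intro h
  rw [Submodule.annihilator_top, h] at ha
  exact nonZeroDivisors.ne_zero ha₀ ha

theorem mem_minimalPrimes_of_height_le_one [IsDomain R] {I p : Ideal R} [p.IsPrime] (hI : I ≠ ⊥)
    (hIp : I ≤ p) (hp : p.height ≤ 1) : p ∈ I.minimalPrimes := by
  have : p.FiniteHeight := p.finiteHeight_iff.2 (.inr (hp.trans_lt ENat.one_lt_top).ne)
  refine Ideal.mem_minimalPrimes_of_height_le hIp (hp.trans ?_)
  rwa [Order.one_le_iff_pos, pos_iff_ne_zero, Ne, Ideal.height_eq_zero_iff_eq_bot]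

end HeightOne

section FittingIdealsAndPseudoIsomorphisms

variable {R M N : Type*} [CommRing R] [AddCommGroup M] [Module R M] [AddCommGroup N] [Module R N]

theorem isPseudoIsomorphic_iff_exists_forall_bijective :
    IsPseudoIsomorphic R M N ↔ ∃ f : M →ₗ[R] N, ∀ (p : Ideal R) [p.IsPrime], p.height ≤ 1 →
      Function.Bijective (LocalizedModule.map p.primeCompl f) := by
  simp only [IsPseudoIsomorphic, IsPseudoNull, bijective_localizedModule_map_iff, ← forall_and]

theorem isPseudoIsomorphic_of_forall_exists_bijective [IsDomain R] [IsNoetherianRing R]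
    [Module.Finite R M] (hM : Module.IsTorsion R M) [Module.Finite R N]
    (hN : Module.IsTorsion R N)
    (h : ∀ (p : Ideal R) [p.IsPrime], p.height = 1 →
      ∃ f : M →ₗ[R] N, Function.Bijective (LocalizedModule.map p.primeCompl f)) :
    IsPseudoIsomorphic R M N := by
  set I := Module.annihilator R M ⊓ Module.annihilator R N
  have hI₀ : I ≠ ⊥ := ne_bot_of_le_ne_bot
    (mul_ne_zero (annihilator_ne_bot_of_isTorsion hM) (annihilator_ne_bot_of_isTorsion hN))
    Ideal.mul_le_inf
  obtain ⟨f, hf⟩ := exists_forall_mem_bijective_localizedModule_map (M := M) (N := N)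
    (P := {p ∈ I.minimalPrimes | p.height = 1})
    ((Ideal.finite_minimalPrimes_of_isNoetherianRing R I).subset (Set.sep_subset _ _))
    (Set.sep_subset _ _) inf_le_right fun p hp _ => h p hp.2
  refine isPseudoIsomorphic_iff_exists_forall_bijective.2 ⟨f, fun p _ hp => ?_⟩
  by_cases hIp : I ≤ p
  · have hp₀ : p.height ≠ 0 := by
      rw [Ne, Ideal.height_eq_zero_iff_eq_bot]
      exact ne_bot_of_le_ne_bot hI₀ hIp
    exact hf p ⟨mem_minimalPrimes_of_height_le_one hI₀ hIp hp,
      hp.antisymm (Order.one_le_iff_pos.2 (pos_iff_ne_zero.2 hp₀))⟩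
  · have := subsingleton_localizedModule_of_not_annihilator_le fun h => hIp (inf_le_left.trans h)
    have := subsingleton_localizedModule_of_not_annihilator_le fun h => hIp (inf_le_right.trans h)
    exact ⟨Function.injective_of_subsingleton _, Function.surjective_to_subsingleton _⟩

theorem fittingIdeal_localizedModule [Module.FinitePresentation R M] (S : Submonoid R) (i : ℕ) :
    fittingIdeal (Localization S) (LocalizedModule S M) i =
      (fittingIdeal R M i).map (algebraMap R (Localization S)) :=
  fittingIdeal_eq_map_of_isBaseChange
    (IsLocalizedModule.isBaseChange S (Localization S) (LocalizedModule.mkLinearMap S M)) i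

theorem exists_bijective_localizedModule_map_of_map_fittingIdeal_eq [IsDomain R]
    [IsNoetherianRing R] [IsIntegrallyClosed R] [Module.Finite R M] (hM : Module.IsTorsion R M)
    [Module.Finite R N] (hN : Module.IsTorsion R N) {p : Ideal R} [p.IsPrime] (hp : p.height = 1)
    (h : ∀ i, (fittingIdeal R M i).map (algebraMap R (Localization p.primeCompl)) =
      (fittingIdeal R N i).map (algebraMap R (Localization p.primeCompl))) :
    ∃ f : M →ₗ[R] N, Function.Bijective (LocalizedModule.map p.primeCompl f) := by
  have := Module.finitePresentation_of_finite R M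
  have := Module.finitePresentation_of_finite R N
  have : IsDomain (Localization p.primeCompl) :=
    IsLocalization.isDomain_localization p.primeCompl_le_nonZeroDivisors
  have := isDiscreteValuationRing_localization hp
  obtain ⟨e⟩ := nonempty_linearEquiv_of_fittingIdeal_eq
    (isTorsion_localizedModule hM p.primeCompl) (isTorsion_localizedModule hN p.primeCompl)
    fun i => by rw [fittingIdeal_localizedModule, fittingIdeal_localizedModule, h i]
  exact exists_bijective_localizedModule_map e

theorem map_fittingIdeal_eq_of_bijective_localizedModule_map [Module.FinitePresentation R M]
    [Module.FinitePresentation R N] {S : Submonoid R} {f : M →ₗ[R] N}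
    (hf : Function.Bijective (LocalizedModule.map S f)) (i : ℕ) :
    (fittingIdeal R M i).map (algebraMap R (Localization S)) =
      (fittingIdeal R N i).map (algebraMap R (Localization S)) := by
  rw [← fittingIdeal_localizedModule, ← fittingIdeal_localizedModule]
  exact fittingIdeal_congr (LinearEquiv.ofBijective _ hf) i

theorem two_le_ringKrullDim_powerSeries {O : Type*} [CommRing O] [IsDomain O]
    [IsDiscreteValuationRing O] : 2 ≤ ringKrullDim O⟦X⟧ := by
  have h := ringKrullDim_succ_le_ringKrullDim_powerseries (R := O)
  rwa [IsDiscreteValuationRing.ringKrullDim_eq_one, one_add_one_eq_two] at h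

theorem mainTheorem10_general [IsDomain R] [IsNoetherianRing R] [IsIntegrallyClosed R]
    (hR : 2 ≤ ringKrullDim R) [Module.Finite R M] (hM : Module.IsTorsion R M) [Module.Finite R N]
    (hN : Module.IsTorsion R N) :
    IsPseudoIsomorphic R M N ↔ ∀ i : ℕ, IdealSim (fittingIdeal R M i) (fittingIdeal R N i) := by
  have := Module.finitePresentation_of_finite R M
  have := Module.finitePresentation_of_finite R N
  simp only [idealSim_iff_forall_map_eq hR]
  constructor
  · intro h i p _ hp
    obtain ⟨f, hf⟩ := isPseudoIsomorphic_iff_exists_forall_bijective.1 h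
    exact map_fittingIdeal_eq_of_bijective_localizedModule_map (hf p hp) i
  · intro h
    exact isPseudoIsomorphic_of_forall_exists_bijective hM hN fun p _ hp =>
      exists_bijective_localizedModule_map_of_map_fittingIdeal_eq hM hN hp fun i => h i p hp.le

end FittingIdealsAndPseudoIsomorphisms

theorem mainTheorem10 {O : Type*} [CommRing O] [IsDomain O] [IsDiscreteValuationRing O]
    [IsAdicComplete (IsLocalRing.maximalIdeal O) O] [Finite (IsLocalRing.ResidueField O)]
    (M : Type*) [AddCommGroup M] [Module O⟦X⟧ M] [Module.Finite O⟦X⟧ M] [Nontrivial M]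
    (hM : Module.IsTorsion O⟦X⟧ M)
    (N : Type*) [AddCommGroup N] [Module O⟦X⟧ N] [Module.Finite O⟦X⟧ N]
    (hN : Module.IsTorsion O⟦X⟧ N) :
    IsPseudoIsomorphic O⟦X⟧ M N ↔
      ∀ i : ℕ, IdealSim (fittingIdeal O⟦X⟧ M i) (fittingIdeal O⟦X⟧ N i) :=
  mainTheorem10_general two_le_ringKrullDim_powerSeries hM hN
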